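/- **Setting.** A Markov decision process (MDP) $\mathcal M=(\mathcal S,\mathcal A,P,\eta,R)$ has a finite state space $\mathcal S$, a countable (discrete) action space $\mathcal A$, deterministic dynamics $P:\mathcal S\times\mathcal A\to\mathcal S$, an initial distribution $\eta$ and a bounded reward $R:\mathcal S\times\mathcal A\to\mathbb R$. A policy assigns to each state $s$ a probability distribution $\pi(\cdot\mid s)$ on $\mathcal A$; it is run by $s^{(0)}\sim\eta$, $a^{(t)}\sim\pi(\cdot\mid s^{(t)})$, $s^{(t+1)}=P(s^{(t)},a^{(t)})$. It is *optimal* if it maximizes the long-run average reward $\liminf_{T}\frac1T\sum_{t<T}\mathbb E\,R(s^{(t)},a^{(t)})$ among all policies. Put $O_{\mathcal M}(s,a)=1$ if some optimal policy visits $(s,a)$ with positive long-run frequency, i.e. $\lim_T\frac1T\sum_{t<T}\Pr(s^{(t)}=s,a^{(t)}=a)>0$, and $O_{\mathcal M}(s,a)=0$ otherwise. An optimal policy $\pi$ is *covering* if $O_{\mathcal M}(s,a)=1$ implies $\pi(a\mid s)>0$. $\mathcal M$ is *unichain* if every policy induces a Markov chain on $\mathcal S$ that is irreducible apart from transient states (it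 has a single recurrent class). A dummy state is a state $s^d$ with $O_{\mathcal M}(s^d,a)=0$ for all $a$; a dummy action is an action $a^d$ with $O_{\mathcal M}(s,a^d)=0$ for all $s$. A *reduction* $(\phi,\psi)\in\Gamma(\mathcal M_x,\mathcal M_y)$ is a pair of maps $\phi:\mathcal S_x\to\mathcal S_y$, $\psi:\mathcal A_x\to\mathcal A_y$ such that 1. $O_{\mathcal M_y}(\phi(s_x),\psi(a_x))=1\Rightarrow O_{\mathcal M_x}(s_x,a_x)=1$ for all $s_x,a_x$; 2. $O_{\mathcal M_y}(s_y,a_y)=1\Rightarrow\phi^{-1}(s_y)\ne\emptyset$ and $\psi^{-1}(a_y)\neq\emptyset$ for all $s_y,a_y$; 3. $O_{\mathcal M_y}(\phi(s_x),\psi(a_x))=1\Rightarrow P_y(\phi(s_x),\psi(a_x))=\phi(P_x(s_x,a_x))$ for all $s_x,a_x$. Given $f:\mathcal S_x\to\mathcal S_y$, $g:\mathcal A_y\to\mathcal A_x$ and a policy $\pi_y$ of $\mathcal M_y$, the adapted policy $\hat\pi_x=g\circ\pi_y\circ f$ has $\hat\pi_x(\cdot\mid s_x)$ equal to the image of $\pi_y(\cdot\mid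 f(s_x))$ under $g$. Its translated execution is $s_x^{(0)}\sim\eta_x$, $\hat s_y^{(t)}=f(s_x^{(t)})$, $\hat a_y^{(t)}\sim\pi_y(\cdot\mid\hat s_y^{(t)})$, $a_x^{(t)}=g(\hat a_y^{(t)})$, $s_x^{(t+1)}=P_x(s_x^{(t)},a_x^{(t)})$. **Theorem.** Let $\mathcal M_x,\mathcal M_y$ be unichain MDPs as above, each having a dummy state and a dummy action, and suppose that $\mathcal M_y$ has an optimal policy (automatic if $\mathcal A_y$ is finite). Then a reduction $(\phi,\psi)\in\Gamma(\mathcal M_x,\mathcal M_y)$ exists if and only if there are maps $f:\mathcal S_x\to\mathcal S_y$ and $g:\mathcal A_y\to\mathcal A_x$, with $g$ injective on the set $\{a_y:\exists s_y,\ O_{\mathcal M_y}(s_y,a_y)=1\}$ of optimal actions, and a covering optimal policy $\pi_y$ of $\mathcal M_y$ such that 1. $\hat\pi_x=g\circ\pi_y\circ f$ is optimal in $\mathcal M_x$; 2. the long-run averaged distributions $$\sigma^{x\to y}_{\hat\pi_x}(s,a,s')=\lim_{T\to\infty}\frac1T\sum_{t=0}^{T-1}\Pr(\hat s_y^{(t)}=s,\hat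 a_y^{(t)}=a,\hat s_y^{(t+1)}=s'),\qquad \sigma^{y}_{\pi_y}(s,a,s')=\lim_{T\to\infty}\frac1T\sum_{t=0}^{T-1}\Pr(s_y^{(t)}=s,a_y^{(t)}=a,s_y^{(t+1)}=s')$$ (the second one for $\pi_y$ run in $\mathcal M_y$) exist and are equal for all $s,s'\in\mathcal S_y$, $a\in\mathcal A_y$. -/

import Mathlib

open Filter Topology

/-- A Markov decision process with deterministic dynamics `P`, initial state distribution `η`
and a bounded reward function `R`. -/
structure MDP (S A : Type*) where
  P : S → A → S
  η : PMF S
  R : S → A → ℝ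
  bounded : ∃ B : ℝ, ∀ s a, |R s a| ≤ B

/-- A (stationary, stochastic) policy. -/
abbrev Policy (S A : Type*) := S → PMF A

/-- The average `(1/T) ∑_{t<T} Pr(X_t = x)`, where `p t` is the law of `X_t`. -/
noncomputable def averagedLaw {α : Type*} (p : ℕ → PMF α) (T : ℕ) (x : α) : ℝ :=
  (∑ t ∈ Finset.range T, (p t x).toReal) / T

/-- The averaged laws converge pointwise to `σ`; that is, `σ` is the long-run averaged
distribution of the process whose time-`t` law is `p t`. -/
def HasLongRunLaw {α : Type*} (p : ℕ → PMF α) (σ : α → ℝ) : Prop :=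
  ∀ x, Tendsto (fun T => averagedLaw p T x) atTop (𝓝 (σ x))

namespace MDP

variable {S A : Type*}

/-- The law of the state at time `t`: `s₀ ∼ η`, `a_t ∼ π(· | s_t)`, `s_{t+1} = P(s_t, a_t)`. -/
noncomputable def stateLaw (M : MDP S A) (π : Policy S A) : ℕ → PMF S
  | 0 => M.η
  | t + 1 => (M.stateLaw π t).bind fun s => (π s).map (M.P s)

/-- The law of `(s_t, a_t)`. -/
noncomputable def pairLaw (M : MDP S A) (π : Policy S A) (t : ℕ) : PMF (S × A) :=
  (M.stateLaw π t).bind fun s => (π s).map fun a => (s, a)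

/-- The law of `(s_t, a_t, s_{t+1})`. -/
noncomputable def tripletLaw (M : MDP S A) (π : Policy S A) (t : ℕ) : PMF (S × A × S) :=
  (M.stateLaw π t).bind fun s => (π s).map fun a => (s, a, M.P s a)

/-- The expected reward `E[R(s_t, a_t)]`. -/
noncomputable def expectedReward (M : MDP S A) (π : Policy S A) (t : ℕ) : ℝ :=
  ∑' z : S × A, (M.pairLaw π t z).toReal * M.R z.1 z.2

/-- The long-run average reward of a policy. -/
noncomputable def gain (M : MDP S A) (π : Policy S A) : ℝ :=
  liminf (fun T : ℕ => (∑ t ∈ Finset.range T, M.expectedReward π t) / T) atTop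

/-- A policy is optimal if no policy has a larger long-run average reward. -/
def IsOptimal (M : MDP S A) (π : Policy S A) : Prop :=
  ∀ π' : Policy S A, M.gain π' ≤ M.gain π

/-- `O(s, a) = 1`: some optimal policy takes action `a` in state `s` with positive long-run
frequency, i.e. `(s, a)` is in the support of its long-run state-action distribution. -/
def O (M : MDP S A) (s : S) (a : A) : Prop :=
  ∃ (π : Policy S A) (σ : S × A → ℝ),
    M.IsOptimal π ∧ HasLongRunLaw (M.pairLaw π) σ ∧ 0 < σ (s, a)

/-- An optimal policy is covering if it plays every optimal action of every state. -/
def IsCovering (M : MDP S A) (π : Policy S A) : Prop :=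
  M.IsOptimal π ∧ ∀ s a, M.O s a → a ∈ (π s).support

/-- Transitions of positive probability in the Markov chain induced by `π`. -/
def Step (M : MDP S A) (π : Policy S A) (s s' : S) : Prop :=
  ∃ a ∈ (π s).support, M.P s a = s'

/-- `s'` is accessible from `s` in the Markov chain induced by `π`. -/
def Reach (M : MDP S A) (π : Policy S A) : S → S → Prop :=
  Relation.ReflTransGen (M.Step π)

/-- Recurrent states of the chain induced by `π` (for finite state spaces): every state
accessible from `s` leads back to `s`. -/
def Recurrent (M : MDP S A) (π : Policy S A) (s : S) : Prop :=
  ∀ s', M.Reach π s s' → M.Reach π s' s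

/-- Every policy induces a Markov chain that is irreducible apart from transient states: it has
a single recurrent class. -/
def Unichain (M : MDP S A) : Prop :=
  ∀ (π : Policy S A) (s s' : S), M.Recurrent π s → M.Recurrent π s' → M.Reach π s s'

/-- The standing assumption: unichain, with a dummy state and a dummy action. -/
structure Regular (M : MDP S A) : Prop where
  unichain : M.Unichain
  dummyState : ∃ sd : S, ∀ a, ¬ M.O sd a
  dummyAction : ∃ ad : A, ∀ s, ¬ M.O s ad

/-- Actions that are optimal in at least one state. -/
def optimalActions (M : MDP S A) : Set A := {a | ∃ s, M.O s a}

end MDP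

section TwoDomains

variable {Sx Ax Sy Ay : Type*}

/-- `Γ(Mx, My)`, the set of reductions from `Mx` to `My`. -/
def reductions (Mx : MDP Sx Ax) (My : MDP Sy Ay) : Set ((Sx → Sy) × (Ax → Ay)) :=
  {r | (∀ s a, My.O (r.1 s) (r.2 a) → Mx.O s a) ∧
    (∀ s' a', My.O s' a' → (∃ s, r.1 s = s') ∧ (∃ a, r.2 a = a')) ∧
    (∀ s a, My.O (r.1 s) (r.2 a) → My.P (r.1 s) (r.2 a) = r.1 (Mx.P s a))}

/-- The adapted policy `g ∘ π ∘ f`: its action law at `s` is the image under `g` of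
`π(· | f s)`. -/
noncomputable def adaptedPolicy (f : Sx → Sy) (g : Ay → Ax) (π : Policy Sy Ay) :
    Policy Sx Ax :=
  fun s => (π (f s)).map g

/-- The law of `(ŝ_t, â_t, ŝ_{t+1})` in the co-domain execution: the adapted policy is run in
`Mx` from `s₀ ∼ η_x`, with `ŝ_t = f(s_t)`, `â_t ∼ π(· | ŝ_t)`, `a_t = g(â_t)` and
`s_{t+1} = P_x(s_t, a_t)`. -/
noncomputable def translatedLaw (Mx : MDP Sx Ax) (f : Sx → Sy) (g : Ay → Ax)
    (π : Policy Sy Ay) (t : ℕ) : PMF (Sy × Ay × Sy) :=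
  (Mx.stateLaw (adaptedPolicy f g π) t).bind fun s =>
    (π (f s)).map fun a => (f s, a, f (Mx.P s (g a)))

end TwoDomains

/-!
For a finite chain with a single recurrent class the averaged laws converge, from any initial
law, to the unique stationary law `μ`: cluster points are stationary, and two stationary laws
agree because the positive and negative parts of their difference would live on disjoint closed
sets (`IsStationaryLaw.unique`, `IsStationaryLaw.hasLongRunLaw`). The law `μ` lives on every
nonempty closed set (`IsStationaryLaw.mem_of_pos`). Hence `O(s, a)` means that some optimal
policy has `μ s > 0` and plays `a` at `s`, the gain is the `μ`-expectation of the reward, and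
both triplet laws have explicit limits.

The facts about optimality rest on a potential: for the optimal gain `g` there is an `h` with
`R(s, a) + h(P(s, a)) ≤ g + h(s)` for all pairs, although the action set may be infinite and
suprema need not be attained (`MDP.exists_isPotential`; `h` is the supremum of `R - g` over
walks, finite because a closed walk is followed by a policy of gain at most `g`). By complementary
slackness a policy is optimal exactly when the inequality is tight at its recurrent pairs. So
a policy whose recurrent pairs are all optimal is optimal (`MDP.isOptimal_of_O`), covering
policies exist (`MDP.exists_isCovering`), and every state with an optimal action is recurrent
under every covering policy (`MDP.IsCovering.pos_of_O`).

Given a reduction `(φ, ψ)`, take `f = φ`, a section `g` of `ψ` over the optimal actions, and a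
covering policy `π`. The states over recurrent states of `π` form a closed set on which `φ`
intertwines the dynamics and only optimal actions are played, so the adapted policy is optimal
and `φ` maps its stationary law to that of `π` (`isOptimal_adaptedPolicy_of_reduction`).
Conversely, let `φ` be `f` on the recurrent states of the adapted policy and the dummy state
elsewhere, and let `ψ` invert `g` on the optimal actions and be the dummy action elsewhere; the
equality of the supports of the two limits gives the surjectivity and the compatibility with the
dynamics (`exists_reduction_of_adaptedPolicy`).
-/

/-! ### Finite Markov chains with a single recurrent class -/

section Chain

variable {S : Type*}

/-- The law at time `t` of the Markov chain with transition kernel `K` and initial law `η`. -/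
noncomputable def chainLaw (K : S → PMF S) (η : PMF S) : ℕ → PMF S
  | 0 => η
  | t + 1 => (chainLaw K η t).bind K

/-- A set of states that the chain with kernel `K` cannot leave. -/
def IsClosedFor (K : S → PMF S) (C : Set S) : Prop :=
  ∀ s ∈ C, ∀ s' ∈ (K s).support, s' ∈ C

/-- Any two nonempty closed sets meet; for a finite state space this says that the chain has a
single recurrent class. -/
def HasSingleClass (K : S → PMF S) : Prop :=
  ∀ C D : Set S, IsClosedFor K C → IsClosedFor K D → C.Nonempty → D.Nonempty →
    (C ∩ D).Nonempty

/-- A stationary probability vector of the kernel `K`. -/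
structure IsStationaryLaw [Fintype S] (K : S → PMF S) (μ : S → ℝ) : Prop where
  mem : μ ∈ stdSimplex ℝ S
  eq : ∀ s', ∑ s, μ s * (K s s').toReal = μ s'

theorem PMF.sum_toReal [Fintype S] (p : PMF S) : ∑ s, (p s).toReal = 1 := by
  rw [← ENNReal.toReal_sum (fun s _ => p.apply_ne_top s),
    ← tsum_fintype (L := .unconditional S), p.tsum_coe]
  simp

theorem PMF.toReal_pos_iff {α : Type*} (p : PMF α) (a : α) :
    0 < (p a).toReal ↔ a ∈ p.support := by
  rw [ENNReal.toReal_pos_iff, PMF.mem_support_iff, pos_iff_ne_zero]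
  simp [(p.apply_ne_top a).lt_top]

theorem PMF.bind_toReal [Fintype S] {β : Type*} (p : PMF S) (q : S → PMF β) (b : β) :
    (p.bind q b).toReal = ∑ s, (p s).toReal * (q s b).toReal := by
  rw [PMF.bind_apply, tsum_fintype, ENNReal.toReal_sum]
  · simp
  · exact fun s _ => ENNReal.mul_ne_top (p.apply_ne_top s) ((q s).apply_ne_top b)

theorem averagedLaw_mem_stdSimplex [Fintype S] (p : ℕ → PMF S) {T : ℕ} (hT : T ≠ 0) :
    averagedLaw p T ∈ stdSimplex ℝ S := by
  refine ⟨fun s => div_nonneg (Finset.sum_nonneg fun t _ => ENNReal.toReal_nonneg)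
    (Nat.cast_nonneg T), ?_⟩
  unfold averagedLaw
  rw [← Finset.sum_div, Finset.sum_comm]
  have hT' : (T : ℝ) ≠ 0 := Nat.cast_ne_zero.2 hT
  simp [PMF.sum_toReal, hT']

/-- One step of the kernel moves the averaged law by a telescoping term of order `1 / T`. -/
theorem sum_averagedLaw_mul [Fintype S] (K : S → PMF S) (η : PMF S) (T : ℕ) (s' : S) :
    ∑ s, averagedLaw (chainLaw K η) T s * (K s s').toReal - averagedLaw (chainLaw K η) T s' =
      ((chainLaw K η T s').toReal - (η s').toReal) / T := by
  have h : ∀ t, ∑ s, (chainLaw K η t s).toReal * (K s s').toReal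
      = (chainLaw K η (t + 1) s').toReal := fun t => (PMF.bind_toReal _ _ _).symm
  have h0 : (η s').toReal = (chainLaw K η 0 s').toReal := rfl
  rw [h0, ← Finset.sum_range_sub (fun t => (chainLaw K η t s').toReal)]
  simp_rw [averagedLaw, Finset.sum_sub_distrib, ← h, sub_div, div_mul_eq_mul_div]
  rw [← Finset.sum_div, Finset.sum_comm]
  simp_rw [Finset.sum_mul]

theorem tendsto_sum_averagedLaw_mul_sub [Fintype S] (K : S → PMF S) (η : PMF S) (s' : S) :
    Tendsto (fun T => ∑ s, averagedLaw (chainLaw K η) T s * (K s s').toReal -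
      averagedLaw (chainLaw K η) T s') atTop (𝓝 0) := by
  simp_rw [sum_averagedLaw_mul]
  refine squeeze_zero_norm (a := fun T : ℕ => 1 / (T : ℝ)) (fun T => ?_)
    tendsto_one_div_atTop_nhds_zero_nat
  have hle : ∀ p : PMF S, (p s').toReal ≤ 1 := fun p =>
    ENNReal.toReal_mono ENNReal.one_ne_top (p.coe_le_one s')
  have h0 : ∀ p : PMF S, 0 ≤ (p s').toReal := fun p => ENNReal.toReal_nonneg
  rw [norm_div, Real.norm_natCast]
  gcongr
  rw [Real.norm_eq_abs, abs_le]
  constructor <;> linarith [hle (chainLaw K η T), hle η, h0 (chainLaw K η T), h0 η]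

theorem IsStationaryLaw.of_mapClusterPt [Fintype S] {K : S → PMF S} {η : PMF S} {μ : S → ℝ}
    (hμ : μ ∈ stdSimplex ℝ S) (h : MapClusterPt μ atTop (averagedLaw (chainLaw K η))) :
    IsStationaryLaw K μ := by
  refine ⟨hμ, fun s' => ?_⟩
  have hc : Continuous fun ν : S → ℝ => ∑ s, ν s * (K s s').toReal - ν s' := by fun_prop
  have h1 := h.continuousAt_comp hc.continuousAt
  have h2 := tendsto_sum_averagedLaw_mul_sub K η s'
  exact sub_eq_zero.1 (eq_of_nhds_neBot (ClusterPt.mono h1 h2))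

theorem exists_isStationaryLaw [Fintype S] (K : S → PMF S) (η : PMF S) :
    ∃ μ, IsStationaryLaw K μ := by
  obtain ⟨μ, hμ, h⟩ := (isCompact_stdSimplex ℝ S).exists_mapClusterPt
    (u := averagedLaw (chainLaw K η)) (f := atTop)
    (tendsto_principal.2 <| (eventually_ne_atTop 0).mono fun T hT =>
      averagedLaw_mem_stdSimplex _ hT)
  exact ⟨μ, .of_mapClusterPt hμ h⟩

/-- The support of a nonnegative vector invariant under the kernel is closed. -/
theorem isClosedFor_of_invariant [Fintype S] {K : S → PMF S} {μ : S → ℝ} (h0 : ∀ s, 0 ≤ μ s)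
    (h : ∀ s', ∑ s, μ s * (K s s').toReal = μ s') : IsClosedFor K {s | 0 < μ s} := by
  intro s hs s' hs'
  rw [Set.mem_ofPred_eq, ← h s']
  exact Finset.sum_pos' (fun i _ => mul_nonneg (h0 i) ENNReal.toReal_nonneg)
    ⟨s, Finset.mem_univ s, mul_pos hs ((PMF.toReal_pos_iff _ _).2 hs')⟩

theorem IsStationaryLaw.isClosedFor [Fintype S] {K : S → PMF S} {μ : S → ℝ}
    (h : IsStationaryLaw K μ) : IsClosedFor K {s | 0 < μ s} :=
  isClosedFor_of_invariant h.mem.1 h.eq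

theorem IsStationaryLaw.exists_pos [Fintype S] {K : S → PMF S} {μ : S → ℝ}
    (h : IsStationaryLaw K μ) : ∃ s, 0 < μ s := by
  by_contra! hc
  have := h.mem.2
  linarith [Finset.sum_nonpos fun s (_ : s ∈ Finset.univ) => hc s]

/-- If `d` is invariant under a stochastic kernel, so is `|d|`: the triangle inequality gives
`|d| ≤ |d| K`, and both sides have the same total mass. -/
theorem abs_invariant [Fintype S] {K : S → PMF S} {d : S → ℝ}
    (h : ∀ s', ∑ s, d s * (K s s').toReal = d s') (s' : S) :
    ∑ s, |d s| * (K s s').toReal = |d s'| := by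
  have hle : ∀ x ∈ Finset.univ, |d x| ≤ ∑ s, |d s| * (K s x).toReal := fun x _ => by
    conv_lhs => rw [← h x]
    refine (Finset.abs_sum_le_sum_abs _ _).trans_eq (Finset.sum_congr rfl fun s _ => ?_)
    rw [abs_mul, abs_of_nonneg ENNReal.toReal_nonneg]
  have hsum : ∑ x, |d x| = ∑ x, ∑ s, |d s| * (K s x).toReal := by
    rw [Finset.sum_comm]
    simp_rw [← Finset.mul_sum, PMF.sum_toReal, mul_one]
  exact ((Finset.sum_eq_sum_iff_of_le hle).1 hsum s' (Finset.mem_univ _)).symm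

/-- Uniqueness of the stationary law: the positive and the negative part of the difference of
two stationary laws are invariant, and their supports are disjoint closed sets. -/
theorem IsStationaryLaw.unique [Fintype S] {K : S → PMF S} (hK : HasSingleClass K) {μ ν : S → ℝ}
    (hμ : IsStationaryLaw K μ) (hν : IsStationaryLaw K ν) : μ = ν := by
  have hd : ∀ s', ∑ s, (μ s - ν s) * (K s s').toReal = μ s' - ν s' := fun s' => by
    simp_rw [sub_mul, Finset.sum_sub_distrib, hμ.eq, hν.eq]
  have ha := abs_invariant (d := fun s => μ s - ν s) hd
  have hpos : IsClosedFor K {s | 0 < |μ s - ν s| + (μ s - ν s)} :=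
    isClosedFor_of_invariant (fun s => by linarith [neg_abs_le (μ s - ν s)]) fun s' => by
      simp_rw [add_mul, Finset.sum_add_distrib, ha, hd]
  have hneg : IsClosedFor K {s | 0 < |μ s - ν s| - (μ s - ν s)} :=
    isClosedFor_of_invariant (fun s => by linarith [le_abs_self (μ s - ν s)]) fun s' => by
      simp_rw [sub_mul (|_|), Finset.sum_sub_distrib, ha, hd]
  have hsum : ∑ s, μ s = ∑ s, ν s := hμ.mem.2.trans hν.mem.2.symm
  by_contra hne
  obtain ⟨x, hx⟩ := Function.ne_iff.1 hne
  have h1 : ∃ s, ν s < μ s := by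
    by_contra! hc
    exact hx ((Finset.sum_eq_sum_iff_of_le fun s _ => hc s).1 hsum x (Finset.mem_univ x))
  have h2 : ∃ s, μ s < ν s := by
    by_contra! hc
    exact hx ((Finset.sum_eq_sum_iff_of_le fun s _ => hc s).1 hsum.symm x (Finset.mem_univ x)).symm
  obtain ⟨a, ha1⟩ := h1
  obtain ⟨b, hb1⟩ := h2
  obtain ⟨c, hc1, hc2⟩ := hK _ _ hpos hneg
    ⟨a, by have := abs_nonneg (μ a - ν a); simp only [Set.mem_ofPred_eq]; linarith⟩
    ⟨b, by have := abs_nonneg (μ b - ν b); simp only [Set.mem_ofPred_eq]; linarith⟩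
  simp only [Set.mem_ofPred_eq] at hc1 hc2
  rcases abs_cases (μ c - ν c) with h | h <;> linarith

/-- The averaged laws of a chain with a single recurrent class converge to its stationary law
from every initial law: they stay in the compact simplex, and every cluster point is
stationary. -/
theorem IsStationaryLaw.hasLongRunLaw [Fintype S] {K : S → PMF S} (hK : HasSingleClass K)
    {μ : S → ℝ} (hμ : IsStationaryLaw K μ) (η : PMF S) : HasLongRunLaw (chainLaw K η) μ := by
  have : Tendsto (averagedLaw (chainLaw K η)) atTop (𝓝 μ) :=
    (isCompact_stdSimplex ℝ S).tendsto_nhds_of_unique_mapClusterPt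
      ((eventually_ne_atTop 0).mono fun T hT => averagedLaw_mem_stdSimplex _ hT)
      fun ν hν h => (IsStationaryLaw.of_mapClusterPt hν h).unique hK hμ
  exact tendsto_pi_nhds.1 this

theorem chainLaw_support_subset {K : S → PMF S} {C : Set S} (hC : IsClosedFor K C) {η : PMF S}
    (hη : η.support ⊆ C) (t : ℕ) : (chainLaw K η t).support ⊆ C := by
  induction t with
  | zero => exact hη
  | succ t ih =>
    intro s hs
    obtain ⟨x, hx, hxs⟩ := (PMF.mem_support_bind_iff _ _ _).1 hs
    exact hC x (ih hx) s hxs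

/-- The stationary law lives on every nonempty closed set, since the chain can be started
there. -/
theorem IsStationaryLaw.mem_of_pos [Fintype S] {K : S → PMF S} (hK : HasSingleClass K)
    {μ : S → ℝ} (hμ : IsStationaryLaw K μ) {C : Set S} (hC : IsClosedFor K C) (hne : C.Nonempty)
    {s : S} (hs : 0 < μ s) : s ∈ C := by
  obtain ⟨c, hc⟩ := hne
  by_contra hsC
  have h0 : ∀ T, averagedLaw (chainLaw K (PMF.pure c)) T s = 0 := fun T => by
    have : ∀ t, chainLaw K (PMF.pure c) t s = 0 := fun t => by
      rw [PMF.apply_eq_zero_iff]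
      exact fun h => hsC (chainLaw_support_subset hC (by simpa using hc) t h)
    simp [averagedLaw, this]
  have := hμ.hasLongRunLaw hK (PMF.pure c) s
  simp_rw [h0] at this
  exact hs.ne (tendsto_nhds_unique tendsto_const_nhds this)

end Chain

/-! ### Gains and potentials -/

section Expect

variable {A : Type*}

/-- The expectation of `F` under `p`. -/
noncomputable def expect (p : PMF A) (F : A → ℝ) : ℝ :=
  ∑' a, (p a).toReal * F a

theorem PMF.summable_toReal (p : PMF A) : Summable fun a => (p a).toReal :=
  ENNReal.summable_toReal (by rw [p.tsum_coe]; exact ENNReal.one_ne_top)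

theorem PMF.tsum_toReal (p : PMF A) : ∑' a, (p a).toReal = 1 := by
  rw [← ENNReal.tsum_toReal_eq p.apply_ne_top, p.tsum_coe, ENNReal.toReal_one]

theorem PMF.summable_toReal_mul (p : PMF A) {F : A → ℝ} {B : ℝ} (hF : ∀ a, |F a| ≤ B) :
    Summable fun a => (p a).toReal * F a := by
  refine Summable.of_norm_bounded (p.summable_toReal.mul_right B) fun a => ?_
  rw [norm_mul, Real.norm_of_nonneg ENNReal.toReal_nonneg]
  exact mul_le_mul_of_nonneg_left (hF a) ENNReal.toReal_nonneg

theorem expect_const (p : PMF A) (c : ℝ) : expect p (fun _ => c) = c := by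
  rw [expect, tsum_mul_right, p.tsum_toReal, one_mul]

theorem expect_nonneg (p : PMF A) {F : A → ℝ} (hF : ∀ a, 0 ≤ F a) : 0 ≤ expect p F :=
  tsum_nonneg fun a => mul_nonneg ENNReal.toReal_nonneg (hF a)

theorem expect_pure (a : A) (F : A → ℝ) : expect (PMF.pure a) F = F a := by
  classical
  rw [expect, tsum_eq_single a fun b hb => by simp [PMF.pure_apply, hb]]
  simp

/-- The law of the image of `p` under a map to a finite type computes expectations. -/
theorem expect_comp {S : Type*} [Fintype S] (p : PMF A) (f : A → S) (h : S → ℝ) :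
    expect p (fun a => h (f a)) = ∑ s, (p.map f s).toReal * h s := by
  classical
  have key : ∀ s, (p.map f s).toReal = ∑' a, (p a).toReal * if s = f a then 1 else 0 := by
    intro s
    rw [PMF.map_apply, ENNReal.tsum_toReal_eq fun a => by split_ifs <;> simp [p.apply_ne_top]]
    exact tsum_congr fun a => by split_ifs <;> simp
  have hs : ∀ s, Summable fun a => (p a).toReal * (if s = f a then (1 : ℝ) else 0) := fun s =>
    p.summable_toReal_mul (B := 1) fun a => by split_ifs <;> simp
  simp_rw [key, ← tsum_mul_right]
  rw [← Summable.tsum_finsetSum fun s _ => (hs s).mul_right (h s), expect]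
  exact tsum_congr fun a => by simp

end Expect

theorem HasLongRunLaw.bind {S β : Type*} [Fintype S] {p : ℕ → PMF S} {μ : S → ℝ}
    (h : HasLongRunLaw p μ) (q : S → PMF β) :
    HasLongRunLaw (fun t => (p t).bind q) fun b => ∑ s, μ s * (q s b).toReal := by
  intro b
  have : ∀ T, averagedLaw (fun t => (p t).bind q) T b =
      ∑ s, averagedLaw p T s * (q s b).toReal := fun T => by
    simp_rw [averagedLaw, PMF.bind_toReal, div_mul_eq_mul_div]
    rw [← Finset.sum_div, Finset.sum_comm]
    simp_rw [Finset.sum_mul]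
  simp_rw [this]
  exact tendsto_finsetSum _ fun s _ => (h s).mul_const _

theorem HasLongRunLaw.unique {α : Type*} {p : ℕ → PMF α} {σ τ : α → ℝ}
    (h : HasLongRunLaw p σ) (h' : HasLongRunLaw p τ) : σ = τ :=
  funext fun x => tendsto_nhds_unique (h x) (h' x)

namespace MDP

variable {S A : Type*} {M : MDP S A} {π : Policy S A} {μ : S → ℝ}

/-- The transition kernel on states induced by a policy. -/
noncomputable def kernel (M : MDP S A) (π : Policy S A) (s : S) : PMF S :=
  (π s).map (M.P s)

theorem mem_support_kernel {s s' : S} : s' ∈ (M.kernel π s).support ↔ M.Step π s s' :=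
  PMF.mem_support_map_iff _ _ _

theorem stateLaw_eq (M : MDP S A) (π : Policy S A) :
    M.stateLaw π = chainLaw (M.kernel π) M.η := by
  funext t
  induction t with
  | zero => rfl
  | succ t ih => rw [stateLaw, ih]; rfl

/-- A state of a closed set from which the fewest states are accessible is recurrent. -/
theorem exists_recurrent [Finite S] {C : Set S} (hC : IsClosedFor (M.kernel π) C)
    (hne : C.Nonempty) : ∃ s ∈ C, M.Recurrent π s ∧ ∀ s', M.Reach π s s' → s' ∈ C := by
  have hreach : ∀ s ∈ C, ∀ s', M.Reach π s s' → s' ∈ C := fun s hs s' h => by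
    induction h with
    | refl => exact hs
    | tail _ h2 ih => exact hC _ ih _ (mem_support_kernel.2 h2)
  obtain ⟨s, hs, hmin⟩ := Set.exists_min_image C (fun s => {x | M.Reach π s x}.ncard)
    C.toFinite hne
  refine ⟨s, hs, fun s' h => ?_, hreach s hs⟩
  have hsub : {x | M.Reach π s' x} ⊆ {x | M.Reach π s x} := fun x hx => h.trans hx
  have heq := Set.eq_of_subset_of_ncard_le hsub (hmin s' (hreach s hs s' h)) (Set.toFinite _)
  exact heq.symm.subset (Relation.ReflTransGen.refl : M.Reach π s s)

theorem Unichain.hasSingleClass [Finite S] (h : M.Unichain) (π : Policy S A) :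
    HasSingleClass (M.kernel π) := by
  intro C D hC hD hCn hDn
  obtain ⟨s, hs, hr, hsC⟩ := exists_recurrent hC hCn
  obtain ⟨s', hs', hr', -⟩ := exists_recurrent hD hDn
  exact ⟨s', hsC _ (h π s s' hr hr'), hs'⟩

variable [Fintype S]

theorem exists_stationary (M : MDP S A) (π : Policy S A) :
    ∃ μ, IsStationaryLaw (M.kernel π) μ :=
  exists_isStationaryLaw _ M.η

theorem hasLongRunLaw_stateLaw (hM : M.Unichain) (hμ : IsStationaryLaw (M.kernel π) μ) :
    HasLongRunLaw (M.stateLaw π) μ := by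
  rw [stateLaw_eq]
  exact hμ.hasLongRunLaw (hM.hasSingleClass π) _

theorem pairLaw_apply (M : MDP S A) (π : Policy S A) (t : ℕ) (s : S) (a : A) :
    (M.pairLaw π t (s, a)).toReal = (M.stateLaw π t s).toReal * (π s a).toReal := by
  classical
  rw [pairLaw, PMF.bind_toReal, Finset.sum_eq_single s]
  · congr 2
    rw [PMF.map_apply]
    refine (tsum_eq_single a fun b hb => ?_).trans (by simp)
    simp [hb.symm]
  · intro s' _ hs'
    have h0 : (s, a) ∉ ((π s').map fun a => (s', a)).support := by
      rw [PMF.mem_support_map_iff]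
      rintro ⟨b, -, hb⟩
      exact hs' (Prod.ext_iff.1 hb).1
    rw [(PMF.apply_eq_zero_iff _ _).2 h0, ENNReal.toReal_zero, mul_zero]
  · simp

theorem hasLongRunLaw_pairLaw (hM : M.Unichain) (hμ : IsStationaryLaw (M.kernel π) μ) :
    HasLongRunLaw (M.pairLaw π) fun z => μ z.1 * (π z.1 z.2).toReal := by
  rintro ⟨s, a⟩
  simp_rw [averagedLaw, pairLaw_apply, ← Finset.sum_mul, ← div_mul_eq_mul_div]
  exact (hasLongRunLaw_stateLaw hM hμ s).mul_const _

theorem expectedReward_eq (M : MDP S A) (π : Policy S A) (t : ℕ) :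
    M.expectedReward π t = ∑ s, (M.stateLaw π t s).toReal * expect (π s) (M.R s) := by
  obtain ⟨B, hB⟩ := M.bounded
  rw [expectedReward, Summable.tsum_prod
    ((M.pairLaw π t).summable_toReal_mul fun z => hB z.1 z.2), tsum_fintype]
  simp_rw [pairLaw_apply, mul_assoc, tsum_mul_left, expect]

/-- In a unichain model the gain is the expected reward under the stationary law. -/
theorem gain_eq (hM : M.Unichain) (hμ : IsStationaryLaw (M.kernel π) μ) :
    M.gain π = ∑ s, μ s * expect (π s) (M.R s) := by
  refine Tendsto.liminf_eq ?_
  have : ∀ T : ℕ, (∑ t ∈ Finset.range T, M.expectedReward π t) / T =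
      ∑ s, averagedLaw (M.stateLaw π) T s * expect (π s) (M.R s) := fun T => by
    simp_rw [averagedLaw, expectedReward_eq, div_mul_eq_mul_div]
    rw [← Finset.sum_div, Finset.sum_comm]
    simp_rw [Finset.sum_mul]
  simp_rw [this]
  exact tendsto_finsetSum _ fun s _ => (hasLongRunLaw_stateLaw hM hμ s).mul_const _

/-- `h` certifies that no policy has a gain above `g`: it is a supersolution of the
average-reward optimality equation. -/
def IsPotential (M : MDP S A) (g : ℝ) (h : S → ℝ) : Prop :=
  ∀ s a, M.R s a + h (M.P s a) ≤ g + h s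

/-- The gain falls short of `g` by the stationary expectation of the slack of any potential. -/
theorem sub_gain_eq (hM : M.Unichain) (hμ : IsStationaryLaw (M.kernel π) μ) (g : ℝ)
    (h : S → ℝ) : g - M.gain π =
      ∑ s, μ s * expect (π s) fun a => g + h s - (M.R s a + h (M.P s a)) := by
  obtain ⟨B, hB⟩ := M.bounded
  have hsh : ∀ s, Summable fun a => (π s a).toReal * h (M.P s a) := fun s =>
    (π s).summable_toReal_mul (B := ∑ x, |h x|) fun a =>
      Finset.single_le_sum (f := fun x => |h x|) (fun x _ => abs_nonneg _) (Finset.mem_univ _)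
  have hsR : ∀ s, Summable fun a => (π s a).toReal * M.R s a := fun s =>
    (π s).summable_toReal_mul (hB s)
  have he : ∀ s, expect (π s) (fun a => g + h s - (M.R s a + h (M.P s a))) =
      g + h s - (expect (π s) (M.R s) + ∑ s', (M.kernel π s s').toReal * h s') := fun s => by
    rw [kernel, ← expect_comp, ← expect_const (π s) (g + h s), expect_const]
    simp_rw [expect, mul_sub, mul_add]
    rw [Summable.tsum_sub, Summable.tsum_add (hsR s) (hsh s)]
    · congr 1
      simp_rw [← mul_add]
      exact expect_const _ _
    · simp_rw [← mul_add]
      exact (π s).summable_toReal.mul_right _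
    · exact (hsR s).add (hsh s)
  have hstat : ∑ s, μ s * ∑ s', (M.kernel π s s').toReal * h s' = ∑ s, μ s * h s := by
    simp_rw [Finset.mul_sum]
    rw [Finset.sum_comm]
    simp_rw [← mul_assoc, ← Finset.sum_mul, hμ.eq]
  simp_rw [he, mul_sub, mul_add, Finset.sum_sub_distrib, Finset.sum_add_distrib, hstat,
    ← gain_eq hM hμ, ← Finset.sum_mul, hμ.mem.2]
  ring

theorem summable_slack {g : ℝ} {h : S → ℝ} (s : S) :
    Summable fun a => (π s a).toReal * (g + h s - (M.R s a + h (M.P s a))) := by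
  obtain ⟨B, hB⟩ := M.bounded
  refine (π s).summable_toReal_mul (B := |g + h s| + (B + ∑ x, |h x|)) fun a => ?_
  have h1 : |h (M.P s a)| ≤ ∑ x, |h x| :=
    Finset.single_le_sum (f := fun x => |h x|) (fun x _ => abs_nonneg _) (Finset.mem_univ _)
  exact (abs_sub _ _).trans (by gcongr; exact (abs_add_le _ _).trans (add_le_add (hB s a) h1))

/-- Complementary slackness: the bound given by a potential is attained exactly by the policies
whose recurrent pairs are tight. -/
theorem IsPotential.gain_eq_iff {g : ℝ} {h : S → ℝ} (hh : M.IsPotential g h)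
    (hM : M.Unichain) (hμ : IsStationaryLaw (M.kernel π) μ) :
    M.gain π = g ↔
      ∀ s a, 0 < μ s → a ∈ (π s).support → M.R s a + h (M.P s a) = g + h s := by
  have h0 : ∀ s a, 0 ≤ (π s a).toReal * (g + h s - (M.R s a + h (M.P s a))) := fun s a =>
    mul_nonneg ENNReal.toReal_nonneg (sub_nonneg.2 (hh s a))
  have hE : ∀ s, (expect (π s) fun a => g + h s - (M.R s a + h (M.P s a))) = 0 ↔
      ∀ a ∈ (π s).support, M.R s a + h (M.P s a) = g + h s := fun s => by
    rw [expect, ← (summable_slack s).hasSum_iff, hasSum_zero_iff_of_nonneg (h0 s),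
      funext_iff]
    refine forall_congr' fun a => ?_
    rw [Pi.zero_apply, mul_eq_zero, sub_eq_zero, PMF.mem_support_iff, ENNReal.toReal_eq_zero_iff,
      or_iff_left ((π s).apply_ne_top a), or_iff_not_imp_left, eq_comm (a := g + h s)]
  rw [eq_comm, ← sub_eq_zero, sub_gain_eq hM hμ g h, Finset.sum_eq_zero_iff_of_nonneg
    fun s _ => mul_nonneg (hμ.mem.1 s)
      (expect_nonneg _ fun a => sub_nonneg.2 (hh s a))]
  simp_rw [mul_eq_zero, hE, Finset.mem_univ, true_imp_iff, or_iff_not_imp_left]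
  exact forall_congr' fun s => ⟨fun H a hs => H hs.ne' a,
    fun H hs a => H a ((hμ.mem.1 s).lt_of_ne' hs)⟩

end MDP

/-! ### Walks and the existence of potentials -/

namespace MDP

variable {S A : Type*} {M : MDP S A} {π : Policy S A} {μ : S → ℝ}

/-- The state reached from `s` by playing the list of actions `l`. -/
def run (M : MDP S A) (s : S) (l : List A) : S :=
  l.foldl M.P s

/-- The sum of `R - g` along the walk that starts at `s` and plays the list of actions `l`. -/
def excess (M : MDP S A) (g : ℝ) : S → List A → ℝ
  | _, [] => 0
  | s, a :: l => M.R s a - g + M.excess g (M.P s a) l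

theorem run_append (s : S) (l l' : List A) : M.run s (l ++ l') = M.run (M.run s l) l' :=
  List.foldl_append

theorem excess_append (g : ℝ) (s : S) (l l' : List A) :
    M.excess g s (l ++ l') = M.excess g s l + M.excess g (M.run s l) l' := by
  induction l generalizing s with
  | nil => simp [excess, run]
  | cons a l ih => simp [excess, ih, run, add_assoc]

theorem excess_eq_sum (g : ℝ) (s : S) (l : List A) (a₀ : A) :
    M.excess g s l =
      ∑ k ∈ Finset.range l.length, (M.R (M.run s (l.take k)) (l.getD k a₀) - g) := by
  induction l generalizing s with
  | nil => simp [excess]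
  | cons a l ih =>
    rw [excess, ih, List.length_cons, Finset.sum_range_succ', add_comm]
    rfl

/-- A walk that visits a state twice contains a closed walk, and removing the closed walk leaves
a walk from the same start to the same end. -/
theorem exists_split {s : S} {l : List A} {i j : ℕ} (hij : i < j) (hj : j ≤ l.length)
    (h : M.run s (l.take i) = M.run s (l.take j)) : ∃ l₁ l₂ l₃, l = l₁ ++ l₂ ++ l₃ ∧
      l₂.length = j - i ∧ M.run (M.run s l₁) l₂ = M.run s l₁ := by
  refine ⟨l.take i, (l.take j).drop i, l.drop j, ?_, by simp [hj], ?_⟩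
  · have : l.take i = (l.take j).take i := by rw [List.take_take, min_eq_left hij.le]
    rw [this, List.take_append_drop, List.take_append_drop]
  · rw [← run_append]
    have : l.take i = (l.take j).take i := by rw [List.take_take, min_eq_left hij.le]
    nth_rewrite 1 [this]
    rw [List.take_append_drop, h]

variable [Fintype S]

/-- A simple closed walk has mean reward at most `g` when no policy has a larger gain: a policy
that follows the walk on its states has the uniform law on the walk as its stationary law. -/
theorem excess_nonpos_of_simple (hM : M.Unichain) {g : ℝ} (hg : ∀ π, M.gain π ≤ g) {s : S}
    {l : List A} (hl : l ≠ []) (hrun : M.run s l = s)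
    (hinj : ∀ i j, i < j → j < l.length → M.run s (l.take i) ≠ M.run s (l.take j)) :
    M.excess g s l ≤ 0 := by
  classical
  obtain ⟨a₀, -⟩ := List.exists_mem_of_ne_nil l hl
  set n := l.length with hn
  set u : ℕ → S := fun k => M.run s (l.take k) with hu
  have hn0 : (n : ℝ) ≠ 0 := by simpa [hn] using hl
  have hstep : ∀ k < n, M.P (u k) (l.getD k a₀) = u (k + 1) := fun k hk => by
    simp only [hu]
    rw [List.take_succ_eq_append_getElem hk, run_append, List.getD_eq_getElem _ _ hk]
    rfl
  have huinj : ∀ i < n, ∀ j < n, u i = u j → i = j := fun i hi j hj h => by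
    rcases lt_trichotomy i j with h' | h' | h'
    · exact absurd h (hinj i j h' hj)
    · exact h'
    · exact absurd h.symm (hinj j i h' hi)
  -- By simplicity of the walk the action to play is determined by the state.
  obtain ⟨π, hπ⟩ : ∃ π : Policy S A, ∀ k < n, π (u k) = PMF.pure (l.getD k a₀) := by
    refine ⟨fun x => if h : ∃ k < n, u k = x then PMF.pure (l.getD h.choose a₀)
      else PMF.pure a₀, fun k hk => ?_⟩
    have h : ∃ k' < n, u k' = u k := ⟨k, hk, rfl⟩
    dsimp only
    rw [dif_pos h, huinj _ h.choose_spec.1 _ hk h.choose_spec.2]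
  set μ : S → ℝ := fun x => (∑ k ∈ Finset.range n, if u k = x then 1 else 0) / n with hμdef
  have hsum : ∀ F : S → ℝ, ∑ x, μ x * F x = (∑ k ∈ Finset.range n, F (u k)) / n := fun F => by
    simp_rw [hμdef, div_mul_eq_mul_div]
    rw [← Finset.sum_div]
    simp_rw [Finset.sum_mul]
    rw [Finset.sum_comm]
    simp
  have hμ : IsStationaryLaw (M.kernel π) μ := by
    refine ⟨⟨fun x => by positivity, ?_⟩, fun x => ?_⟩
    · simpa [hn0] using hsum 1
    · have hk : ∀ k ∈ Finset.range n, (M.kernel π (u k) x).toReal =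
          if u (k + 1) = x then 1 else 0 := fun k hk => by
        have hk := Finset.mem_range.1 hk
        rw [kernel, hπ k hk, PMF.pure_map, hstep k hk, PMF.pure_apply]
        simp only [eq_comm (a := x)]
        split_ifs <;> simp
      have h0 : u n = u 0 := by simpa [hu, hn, run] using hrun
      rw [hsum, Finset.sum_congr rfl hk]
      simp only [hμdef]
      congr 1
      have h1 := Finset.sum_range_succ (fun k => if u k = x then (1 : ℝ) else 0) n
      rw [Finset.sum_range_succ', h0] at h1
      linarith
  have h := hg π
  have hk : ∀ k ∈ Finset.range n, expect (π (u k)) (M.R (u k)) = M.R (u k) (l.getD k a₀) :=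
    fun k hk => by rw [hπ k (Finset.mem_range.1 hk), expect_pure]
  rw [gain_eq hM hμ, hsum fun x => expect (π x) (M.R x), Finset.sum_congr rfl hk,
    div_le_iff₀ (lt_of_le_of_ne (Nat.cast_nonneg n) hn0.symm)] at h
  rw [excess_eq_sum g s l a₀, Finset.sum_sub_distrib]
  simp only [Finset.sum_const, Finset.card_range, nsmul_eq_mul]
  linarith

/-- Every closed walk splits into simple ones. -/
theorem excess_nonpos_of_closed (hM : M.Unichain) {g : ℝ} (hg : ∀ π, M.gain π ≤ g) (n : ℕ) :
    ∀ (s : S) (l : List A), l.length = n → M.run s l = s → M.excess g s l ≤ 0 := by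
  induction n using Nat.strong_induction_on with
  | _ n ih =>
    intro s l hl hrun
    rcases eq_or_ne l [] with rfl | hne
    · simp [excess]
    by_cases hinj : ∀ i j, i < j → j < l.length → M.run s (l.take i) ≠ M.run s (l.take j)
    · exact excess_nonpos_of_simple hM hg hne hrun hinj
    push Not at hinj
    obtain ⟨i, j, hij, hj, h⟩ := hinj
    obtain ⟨l₁, l₂, l₃, rfl, h2, hc⟩ := exists_split hij hj.le h
    simp only [List.length_append] at hl hj
    have e1 := ih _ (by omega) _ l₂ rfl hc
    have e2 := ih (l₁ ++ l₃).length (by rw [List.length_append]; omega) s _ rfl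
      (by rwa [run_append, ← hc, ← run_append, ← run_append, ← List.append_assoc])
    rw [excess_append] at e2
    rw [excess_append, excess_append, run_append, hc]
    linarith

/-- The excess of walks of arbitrary length is bounded: closed parts can be removed until the
walk has at most as many steps as there are states. -/
theorem excess_le (hM : M.Unichain) {g C : ℝ} (hg : ∀ π, M.gain π ≤ g) (hC0 : 0 ≤ C)
    (hC : ∀ s a, M.R s a - g ≤ C) (n : ℕ) :
    ∀ (s : S) (l : List A), l.length = n → M.excess g s l ≤ Fintype.card S * C := by
  induction n using Nat.strong_induction_on with
  | _ n ih =>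
    intro s l hl
    rcases le_or_gt n (Fintype.card S) with hn | hn
    · have h1 : ∀ (l : List A) (s : S), M.excess g s l ≤ l.length * C := fun l => by
        induction l with
        | nil => simp [excess]
        | cons a l ih =>
          intro s
          simp only [excess, List.length_cons, Nat.cast_add, Nat.cast_one]
          linarith [ih (M.P s a), hC s a]
      exact (h1 l s).trans (by rw [hl]; gcongr)
    obtain ⟨x, y, hxy, h⟩ := Fintype.exists_ne_map_eq_of_card_lt
      (fun k : Fin n => M.run s (l.take k)) (by simpa using hn)
    wlog hlt : x < y generalizing x y
    · exact this y x hxy.symm h.symm (lt_of_le_of_ne (not_lt.1 hlt) hxy.symm)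
    obtain ⟨l₁, l₂, l₃, rfl, h2, hc⟩ := exists_split hlt (hl ▸ y.2.le) h
    have hlt' : (x : ℕ) < y := hlt
    simp only [List.length_append] at hl
    have e1 := excess_nonpos_of_closed hM hg _ _ l₂ rfl hc
    have e2 := ih (l₁ ++ l₃).length (by rw [List.length_append]; omega) s _ rfl
    rw [excess_append] at e2
    rw [excess_append, excess_append, run_append, hc]
    linarith

/-- An upper bound `g` for the gains of all policies is certified by a potential, namely the
supremum of `R - g` over all walks from a given state. It is finite since closed walks do not
contribute positively, even if the suprema over the infinite action set are not attained. -/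
theorem exists_isPotential (hM : M.Unichain) {g : ℝ} (hg : ∀ π, M.gain π ≤ g) :
    ∃ h, M.IsPotential g h := by
  obtain ⟨B, hB⟩ := M.bounded
  have hbdd : ∀ s, BddAbove (Set.range (M.excess g s)) := fun s =>
    ⟨Fintype.card S * max (B - g) 0, by
      rintro _ ⟨l, rfl⟩
      exact excess_le hM hg (le_max_right _ _)
        (fun s a => le_max_of_le_left (by linarith [(abs_le.1 (hB s a)).2])) _ s l rfl⟩
  refine ⟨fun s => ⨆ l, M.excess g s l, fun s a => ?_⟩
  have : ⨆ l, M.excess g (M.P s a) l ≤ (⨆ l, M.excess g s l) - (M.R s a - g) :=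
    ciSup_le fun l => by
      have := le_ciSup (hbdd s) (a :: l)
      rw [excess] at this
      linarith
  linarith

/-! ### Optimal state-action pairs and covering policies -/

theorem IsOptimal.O (hπ : M.IsOptimal π) (hM : M.Unichain)
    (hμ : IsStationaryLaw (M.kernel π) μ) {s : S} {a : A} (hs : 0 < μ s)
    (ha : a ∈ (π s).support) : M.O s a :=
  ⟨π, _, hπ, hasLongRunLaw_pairLaw hM hμ, mul_pos hs ((PMF.toReal_pos_iff _ _).2 ha)⟩

theorem O.exists_stationary {s : S} {a : A} (h : M.O s a) (hM : M.Unichain) :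
    ∃ (π : Policy S A) (μ : S → ℝ), M.IsOptimal π ∧ IsStationaryLaw (M.kernel π) μ ∧ 0 < μ s ∧
      a ∈ (π s).support := by
  obtain ⟨π, σ, hπ, hσ, hpos⟩ := h
  obtain ⟨μ, hμ⟩ := M.exists_stationary π
  rw [hσ.unique (hasLongRunLaw_pairLaw hM hμ)] at hpos
  exact ⟨π, μ, hπ, hμ, pos_of_mul_pos_left hpos ENNReal.toReal_nonneg,
    (PMF.toReal_pos_iff _ _).1 (pos_of_mul_pos_right hpos (hμ.mem.1 s))⟩

/-- A policy all of whose recurrent state-action pairs are optimal is itself optimal: the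
potential of the optimal gain is tight at optimal pairs. -/
theorem isOptimal_of_O (hM : M.Unichain) (hμ : IsStationaryLaw (M.kernel π) μ)
    (hO : ∀ s a, 0 < μ s → a ∈ (π s).support → M.O s a) : M.IsOptimal π := by
  obtain ⟨s₀, hs₀⟩ := hμ.exists_pos
  obtain ⟨a₀, ha₀⟩ := (π s₀).support_nonempty
  obtain ⟨π₀, _, hπ₀, -⟩ := (hO s₀ a₀ hs₀ ha₀).exists_stationary hM
  obtain ⟨h, hh⟩ := exists_isPotential hM hπ₀
  have heq : M.gain π = M.gain π₀ := (hh.gain_eq_iff hM hμ).2 fun s a hs ha => by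
    obtain ⟨π', μ', hπ', hμ', hs', ha'⟩ := (hO s a hs ha).exists_stationary hM
    exact (hh.gain_eq_iff hM hμ').1 (le_antisymm (hπ₀ π') (hπ' π₀)) s a hs' ha'
  exact fun π' => (hπ₀ π').trans heq.ge

/-- Playing optimal actions leads to states that have optimal actions. -/
theorem O.next {s : S} {a : A} (h : M.O s a) (hM : M.Unichain) : ∃ b, M.O (M.P s a) b := by
  obtain ⟨π, μ, hπ, hμ, hs, ha⟩ := h.exists_stationary hM
  obtain ⟨b, hb⟩ := (π (M.P s a)).support_nonempty
  exact ⟨b, hπ.O hM hμ (hμ.isClosedFor s hs _ (mem_support_kernel.2 ⟨a, ha, rfl⟩)) hb⟩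

end MDP

/-- Every nonempty subset of a countable type is the support of some distribution. -/
theorem PMF.exists_support_eq {A : Type*} [Countable A] {C : Set A} (hC : C.Nonempty) :
    ∃ p : PMF A, p.support = C := by
  classical
  obtain ⟨w, hw, hsum⟩ := ENNReal.exists_pos_sum_of_countable one_ne_zero A
  have hle : ∑' a, C.indicator (fun a => (w a : ENNReal)) a ≤ ∑' a, (w a : ENNReal) :=
    ENNReal.tsum_le_tsum fun a => Set.indicator_le_self _ _ a
  refine ⟨PMF.normalize (C.indicator fun a => (w a : ENNReal)) ?_ ?_, ?_⟩
  · obtain ⟨a, ha⟩ := hC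
    rw [ENNReal.summable.tsum_ne_zero_iff]
    exact ⟨a, by simp [ha, (hw a).ne']⟩
  · exact (hle.trans_lt (hsum.trans ENNReal.one_lt_top)).ne
  · rw [PMF.support_normalize]
    ext a
    simp [(hw a).ne']

namespace MDP

variable {S A : Type*} {M : MDP S A} {π : Policy S A} {μ : S → ℝ} [Fintype S]

/-- Playing every optimal action wherever there is one (and anything elsewhere) is optimal: the
states with an optimal action form a closed set, which carries the stationary law. -/
theorem exists_isCovering [Countable A] (hM : M.Unichain) (hopt : ∃ π, M.IsOptimal π) :
    ∃ π, M.IsCovering π := by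
  classical
  obtain ⟨π₀, hπ₀⟩ := hopt
  have hex : ∀ s, ∃ p : PMF A, (∃ a, M.O s a) → p.support = {a | M.O s a} := fun s => by
    by_cases h : ∃ a, M.O s a
    · exact (PMF.exists_support_eq h).imp fun p hp _ => hp
    · exact ⟨π₀ s, fun h' => absurd h' h⟩
  choose π hπ using hex
  obtain ⟨μ, hμ⟩ := M.exists_stationary π
  have hclosed : IsClosedFor (M.kernel π) {s | ∃ a, M.O s a} := fun s hs s' hs' => by
    obtain ⟨a, ha, rfl⟩ := mem_support_kernel.1 hs'
    rw [hπ s hs] at ha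
    exact O.next ha hM
  have hne : {s | ∃ a, M.O s a}.Nonempty := by
    obtain ⟨μ₀, hμ₀⟩ := M.exists_stationary π₀
    obtain ⟨s, hs⟩ := hμ₀.exists_pos
    obtain ⟨a, ha⟩ := (π₀ s).support_nonempty
    exact ⟨s, a, hπ₀.O hM hμ₀ hs ha⟩
  refine ⟨π, isOptimal_of_O hM hμ fun s a hs ha => ?_, fun s a h => ?_⟩
  · rwa [hπ s (hμ.mem_of_pos (hM.hasSingleClass π) hclosed hne hs)] at ha
  · rw [hπ s ⟨a, h⟩]
    exact h

/-- Under a covering policy every state with an optimal action is recurrent. If `π₁` is an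
optimal policy under which the state is recurrent, follow `π₁` on its recurrent class and the
covering policy `π` elsewhere: the result has the stationary law of `π₁`, but can leave no set
that `π` cannot leave. -/
theorem IsCovering.pos_of_O (hπ : M.IsCovering π) (hM : M.Unichain)
    (hμ : IsStationaryLaw (M.kernel π) μ) {s : S} {a : A} (h : M.O s a) : 0 < μ s := by
  classical
  obtain ⟨π₁, μ₁, hπ₁, hμ₁, hs, -⟩ := h.exists_stationary hM
  let π₂ : Policy S A := fun x => if 0 < μ₁ x then π₁ x else π x
  have hpos : ∀ x, 0 < μ₁ x → π₂ x = π₁ x := fun x hx => if_pos hx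
  have hμ₂ : IsStationaryLaw (M.kernel π₂) μ₁ := by
    refine ⟨hμ₁.mem, fun x => ?_⟩
    rw [← hμ₁.eq x]
    refine Finset.sum_congr rfl fun y _ => ?_
    rcases (hμ₁.mem.1 y).eq_or_lt with hy | hy
    · rw [← hy, zero_mul, zero_mul]
    · rw [kernel, kernel, hpos y hy]
  have hclosed : IsClosedFor (M.kernel π₂) {x | 0 < μ x} := fun x hx x' hx' => by
    obtain ⟨b, hb, rfl⟩ := mem_support_kernel.1 hx'
    refine hμ.isClosedFor x hx _ (mem_support_kernel.2 ⟨b, ?_, rfl⟩)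
    by_cases hx1 : 0 < μ₁ x
    · rw [hpos x hx1] at hb
      exact hπ.2 x b (hπ₁.O hM hμ₁ hx1 hb)
    · simpa only [π₂, if_neg hx1] using hb
  exact hμ₂.mem_of_pos (hM.hasSingleClass π₂) hclosed hμ.exists_pos hs

end MDP

/-! ### Adapted policies and reductions -/

theorem PMF.map_congr_support {α β : Type*} (p : PMF α) {u v : α → β}
    (h : ∀ a ∈ p.support, u a = v a) : p.map u = p.map v := by
  ext b
  rw [PMF.map_apply, PMF.map_apply]
  refine tsum_congr fun a => ?_
  by_cases ha : a ∈ p.support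
  · rw [h a ha]
  · rw [(p.apply_eq_zero_iff a).2 ha, ite_self, ite_self]

theorem sum_mul_toReal_pos_iff {S β : Type*} [Fintype S] {μ : S → ℝ} (h0 : ∀ s, 0 ≤ μ s)
    (q : S → PMF β) (b : β) :
    0 < ∑ s, μ s * (q s b).toReal ↔ ∃ s, 0 < μ s ∧ b ∈ (q s).support := by
  have hnn : ∀ s, 0 ≤ μ s * (q s b).toReal := fun s => mul_nonneg (h0 s) ENNReal.toReal_nonneg
  constructor
  · intro h
    obtain ⟨s, -, hs⟩ := Finset.exists_lt_of_sum_lt (s := Finset.univ) (f := fun _ : S => (0 : ℝ))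
      (g := fun s => μ s * (q s b).toReal) (by simpa using h)
    exact ⟨s, pos_of_mul_pos_left hs ENNReal.toReal_nonneg,
      (PMF.toReal_pos_iff _ _).1 (pos_of_mul_pos_right hs (h0 s))⟩
  · rintro ⟨s, hs, hb⟩
    exact Finset.sum_pos' (fun s _ => hnn s)
      ⟨s, Finset.mem_univ s, mul_pos hs ((PMF.toReal_pos_iff _ _).2 hb)⟩

section Transfer

variable {Sx Ax Sy Ay : Type*} {Mx : MDP Sx Ax} {My : MDP Sy Ay}
  {f : Sx → Sy} {g : Ay → Ax} {π : Policy Sy Ay} {μx : Sx → ℝ} {μy : Sy → ℝ}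

theorem mem_support_adaptedPolicy {s : Sx} {a : Ax} :
    a ∈ (adaptedPolicy f g π s).support ↔ ∃ b ∈ (π (f s)).support, g b = a :=
  PMF.mem_support_map_iff _ _ _

variable [Fintype Sx]

/-- The limit of the translated laws in the co-domain, as a function of the stationary law. -/
noncomputable def translatedLimit (Mx : MDP Sx Ax) (f : Sx → Sy) (g : Ay → Ax)
    (π : Policy Sy Ay) (μx : Sx → ℝ) (z : Sy × Ay × Sy) : ℝ :=
  ∑ s, μx s * ((π (f s)).map (fun a => (f s, a, f (Mx.P s (g a)))) z).toReal

theorem hasLongRunLaw_translatedLaw (hx : Mx.Unichain)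
    (hμx : IsStationaryLaw (Mx.kernel (adaptedPolicy f g π)) μx) :
    HasLongRunLaw (translatedLaw Mx f g π) (translatedLimit Mx f g π μx) :=
  (MDP.hasLongRunLaw_stateLaw hx hμx).bind _

/-- The support of the translated limit consists of the images of recurrent transitions. -/
theorem translatedLimit_pos_iff (h0 : ∀ s, 0 ≤ μx s) {y y' : Sy} {b : Ay} :
    0 < translatedLimit Mx f g π μx (y, b, y') ↔
      ∃ s, 0 < μx s ∧ f s = y ∧ b ∈ (π y).support ∧ f (Mx.P s (g b)) = y' := by
  refine (sum_mul_toReal_pos_iff h0 _ _).trans (exists_congr fun s => and_congr_right fun _ => ?_)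
  rw [PMF.mem_support_map_iff]
  simp only [Prod.mk.injEq]
  constructor
  · rintro ⟨a, ha, rfl, rfl, rfl⟩
    exact ⟨rfl, ha, rfl⟩
  · rintro ⟨rfl, hb, rfl⟩
    exact ⟨b, hb, rfl, rfl, rfl⟩

variable [Fintype Sy]

/-- The limit of the triplet laws, as a function of the stationary law. -/
noncomputable def tripletLimit (My : MDP Sy Ay) (π : Policy Sy Ay) (μy : Sy → ℝ)
    (z : Sy × Ay × Sy) : ℝ :=
  ∑ s, μy s * ((π s).map (fun a => (s, a, My.P s a)) z).toReal

theorem hasLongRunLaw_tripletLaw (hy : My.Unichain) (hμy : IsStationaryLaw (My.kernel π) μy) :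
    HasLongRunLaw (My.tripletLaw π) (tripletLimit My π μy) :=
  (MDP.hasLongRunLaw_stateLaw hy hμy).bind _

theorem tripletLimit_pos_iff (h0 : ∀ s, 0 ≤ μy s) {y y' : Sy} {b : Ay} :
    0 < tripletLimit My π μy (y, b, y') ↔
      0 < μy y ∧ b ∈ (π y).support ∧ My.P y b = y' := by
  refine (sum_mul_toReal_pos_iff h0 _ _).trans ?_
  simp only [PMF.mem_support_map_iff, Prod.mk.injEq]
  constructor
  · rintro ⟨s, hs, a, ha, rfl, rfl, rfl⟩
    exact ⟨hs, ha, rfl⟩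
  · rintro ⟨hy, hb, rfl⟩
    exact ⟨y, hy, b, hb, rfl, rfl, rfl⟩

/-- The image of a vector on `Sx` under a map to `Sy`: the sum of `μx` over each fibre. -/
noncomputable def pushforward (f : Sx → Sy) (μx : Sx → ℝ) (y : Sy) : ℝ :=
  ∑ s, μx s * (PMF.pure (f s) y).toReal

theorem sum_pushforward_mul (F : Sy → ℝ) :
    ∑ y, pushforward f μx y * F y = ∑ s, μx s * F (f s) := by
  simp_rw [pushforward, Finset.sum_mul, mul_assoc]
  rw [Finset.sum_comm]
  simp_rw [← Finset.mul_sum]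
  refine Finset.sum_congr rfl fun s _ => ?_
  rw [← expect_pure (f s) F, expect, tsum_fintype]

/-- If `f` intertwines the dynamics on the recurrent states of the adapted policy, then it maps
the stationary law of the adapted policy to the stationary law of the policy. -/
theorem isStationaryLaw_pushforward (hμx : IsStationaryLaw (Mx.kernel (adaptedPolicy f g π)) μx)
    (h : ∀ s, 0 < μx s → ∀ b ∈ (π (f s)).support, f (Mx.P s (g b)) = My.P (f s) b) :
    IsStationaryLaw (My.kernel π) (pushforward f μx) := by
  refine ⟨⟨fun y => Finset.sum_nonneg fun s _ =>
    mul_nonneg (hμx.mem.1 s) ENNReal.toReal_nonneg, ?_⟩, fun y => ?_⟩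
  · simpa [hμx.mem.2] using sum_pushforward_mul (f := f) (μx := μx) 1
  · have hk : ∀ s, μx s * (My.kernel π (f s) y).toReal =
        μx s * ∑ x, (Mx.kernel (adaptedPolicy f g π) s x).toReal * (PMF.pure (f x) y).toReal := by
      intro s
      rcases (hμx.mem.1 s).eq_or_lt with hs | hs
      · rw [← hs, zero_mul, zero_mul]
      have hmap : My.kernel π (f s) = (Mx.kernel (adaptedPolicy f g π) s).map f := by
        simp_rw [MDP.kernel, adaptedPolicy, PMF.map_comp]
        exact PMF.map_congr_support _ fun b hb => (h s hs b hb).symm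
      rw [hmap, PMF.map, PMF.bind_toReal]
      rfl
    rw [sum_pushforward_mul fun z => (My.kernel π z y).toReal,
      Finset.sum_congr rfl fun s _ => hk s]
    simp_rw [Finset.mul_sum]
    rw [Finset.sum_comm]
    simp_rw [← mul_assoc, ← Finset.sum_mul, hμx.eq, pushforward]

theorem translatedLimit_eq_tripletLimit (h0 : ∀ s, 0 ≤ μx s)
    (h : ∀ s, 0 < μx s → ∀ b ∈ (π (f s)).support, f (Mx.P s (g b)) = My.P (f s) b) :
    translatedLimit Mx f g π μx = tripletLimit My π (pushforward f μx) := by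
  funext z
  rw [tripletLimit,
    sum_pushforward_mul fun y => ((π y).map (fun a => (y, a, My.P y a)) z).toReal]
  refine Finset.sum_congr rfl fun s _ => ?_
  rcases (h0 s).eq_or_lt with hs | hs
  · rw [← hs, zero_mul, zero_mul]
  · rw [PMF.map_congr_support (π (f s)) fun b hb => by rw [h s hs b hb]]

/-- For a reduction `(φ, ψ)` and a section `g` of `ψ` over the optimal actions, the states of
`Mx` lying over recurrent states of an optimal policy of `My` form a closed set for the adapted
policy. So the recurrent states of the adapted policy lie over recurrent states, and all actions
it plays there are optimal. -/
theorem isOptimal_adaptedPolicy_of_reduction (hx : Mx.Unichain) (hy : My.Unichain) {φ : Sx → Sy}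
    {ψ : Ax → Ay} (hr : (φ, ψ) ∈ reductions Mx My) (hg : ∀ b ∈ My.optimalActions, ψ (g b) = b)
    (hπ : My.IsOptimal π) :
    Mx.IsOptimal (adaptedPolicy φ g π) ∧
      ∃ σ, HasLongRunLaw (translatedLaw Mx φ g π) σ ∧ HasLongRunLaw (My.tripletLaw π) σ := by
  obtain ⟨h1, h2, h3⟩ := hr
  obtain ⟨μx, hμx⟩ := Mx.exists_stationary (adaptedPolicy φ g π)
  obtain ⟨μy, hμy⟩ := My.exists_stationary π
  have hO : ∀ s, 0 < μy (φ s) → ∀ b ∈ (π (φ s)).support, My.O (φ s) (ψ (g b)) ∧ ψ (g b) = b := by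
    intro s hs b hb
    have hOb := hπ.O hy hμy hs hb
    rw [hg b ⟨_, hOb⟩]
    exact ⟨hOb, rfl⟩
  have hP : ∀ s, 0 < μy (φ s) → ∀ b ∈ (π (φ s)).support,
      φ (Mx.P s (g b)) = My.P (φ s) b := fun s hs b hb => by
    obtain ⟨hOb, hb'⟩ := hO s hs b hb
    exact (h3 s (g b) hOb).symm.trans (congrArg _ hb')
  have hclosed : IsClosedFor (Mx.kernel (adaptedPolicy φ g π)) {s | 0 < μy (φ s)} := by
    intro s hs s' hs'
    obtain ⟨a, ha, rfl⟩ := MDP.mem_support_kernel.1 hs'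
    obtain ⟨b, hb, rfl⟩ := mem_support_adaptedPolicy.1 ha
    rw [Set.mem_ofPred_eq, hP s hs b hb]
    exact hμy.isClosedFor _ hs _ (MDP.mem_support_kernel.2 ⟨b, hb, rfl⟩)
  have hne : {s | 0 < μy (φ s)}.Nonempty := by
    obtain ⟨y, hpos⟩ := hμy.exists_pos
    obtain ⟨b, hb⟩ := (π y).support_nonempty
    obtain ⟨⟨s, rfl⟩, -⟩ := h2 y b (hπ.O hy hμy hpos hb)
    exact ⟨s, hpos⟩
  have hrec : ∀ s, 0 < μx s → 0 < μy (φ s) := fun s hs =>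
    hμx.mem_of_pos (hx.hasSingleClass _) hclosed hne hs
  refine ⟨MDP.isOptimal_of_O hx hμx fun s a hs ha => ?_, _, hasLongRunLaw_translatedLaw hx hμx, ?_⟩
  · obtain ⟨b, hb, rfl⟩ := mem_support_adaptedPolicy.1 ha
    exact h1 s _ (hO s (hrec s hs) b hb).1
  · have hP' := fun s (hs : 0 < μx s) => hP s (hrec s hs)
    rw [translatedLimit_eq_tripletLimit hμx.mem.1 hP']
    exact hasLongRunLaw_tripletLaw hy (isStationaryLaw_pushforward hμx hP')

/-- A reduction is obtained from `f` and `g` by sending transient states of the adapted policy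
to the dummy state and actions that are not images of optimal actions to the dummy action. -/
theorem exists_reduction_of_adaptedPolicy (hx : Mx.Unichain) (hy : My.Regular)
    (hg : Set.InjOn g My.optimalActions) (hπ : My.IsCovering π)
    (hopt : Mx.IsOptimal (adaptedPolicy f g π)) {σ : Sy × Ay × Sy → ℝ}
    (hσx : HasLongRunLaw (translatedLaw Mx f g π) σ)
    (hσy : HasLongRunLaw (My.tripletLaw π) σ) :
    ∃ (φ : Sx → Sy) (ψ : Ax → Ay), (φ, ψ) ∈ reductions Mx My := by
  classical
  obtain ⟨sd, hsd⟩ := hy.dummyState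
  obtain ⟨ad, had⟩ := hy.dummyAction
  obtain ⟨μx, hμx⟩ := Mx.exists_stationary (adaptedPolicy f g π)
  obtain ⟨μy, hμy⟩ := My.exists_stationary π
  have hlim : translatedLimit Mx f g π μx = tripletLimit My π μy :=
    ((hasLongRunLaw_translatedLaw hx hμx).unique hσx).trans
      (hσy.unique (hasLongRunLaw_tripletLaw hy.unichain hμy))
  -- The values at transient states and at other actions make no pair optimal, so the three
  -- conditions only concern recurrent states and images of optimal actions.
  let φ : Sx → Sy := fun s => if 0 < μx s then f s else sd
  let ψ : Ax → Ay := fun a => if h : ∃ b ∈ My.optimalActions, g b = a then h.choose else ad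
  have hφ : ∀ s, 0 < μx s → φ s = f s := fun s hs => if_pos hs
  have hψ : ∀ b ∈ My.optimalActions, ψ (g b) = b := fun b hb => by
    have h : ∃ b' ∈ My.optimalActions, g b' = g b := ⟨b, hb, rfl⟩
    have : ψ (g b) = h.choose := dif_pos h
    exact this.trans (hg h.choose_spec.1 hb h.choose_spec.2)
  have key : ∀ s a, My.O (φ s) (ψ a) → 0 < μx s ∧ My.O (f s) (ψ a) ∧ g (ψ a) = a := by
    intro s a h
    have hs : 0 < μx s := by
      by_contra hs
      rw [show φ s = sd from if_neg hs] at h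
      exact hsd _ h
    rw [hφ s hs] at h
    refine ⟨hs, h, ?_⟩
    by_cases ha : ∃ b ∈ My.optimalActions, g b = a
    · obtain ⟨b, hb, rfl⟩ := ha
      rw [hψ b hb]
    · rw [show ψ a = ad from dif_neg ha] at h
      exact absurd h (had _)
  refine ⟨φ, ψ, fun s a h => ?_, fun y b h => ?_, fun s a h => ?_⟩
  · obtain ⟨hs, hO, ha⟩ := key s a h
    exact hopt.O hx hμx hs (mem_support_adaptedPolicy.2 ⟨_, hπ.2 _ _ hO, ha⟩)
  · have hpos : 0 < tripletLimit My π μy (y, b, My.P y b) :=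
      (tripletLimit_pos_iff hμy.mem.1).2 ⟨hπ.pos_of_O hy.unichain hμy h, hπ.2 y b h, rfl⟩
    rw [← hlim, translatedLimit_pos_iff hμx.mem.1] at hpos
    obtain ⟨s, hs, hfs, -⟩ := hpos
    exact ⟨⟨s, (hφ s hs).trans hfs⟩, g b, hψ b ⟨y, h⟩⟩
  · obtain ⟨hs, hO, ha⟩ := key s a h
    have hb := hπ.2 _ _ hO
    have hs' : 0 < μx (Mx.P s a) := hμx.isClosedFor s hs _
      (MDP.mem_support_kernel.2 ⟨a, mem_support_adaptedPolicy.2 ⟨_, hb, ha⟩, rfl⟩)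
    have hpos : 0 < translatedLimit Mx f g π μx (f s, ψ a, f (Mx.P s (g (ψ a)))) :=
      (translatedLimit_pos_iff hμx.mem.1).2 ⟨s, hs, rfl, hb, rfl⟩
    rw [hlim, tripletLimit_pos_iff hμy.mem.1, ha] at hpos
    dsimp only
    rw [hφ s hs, hφ _ hs']
    exact hpos.2.2

end Transfer

theorem mainTheorem2 {Sx Ax Sy Ay : Type*} [Finite Sx] [Countable Ax] [Finite Sy] [Countable Ay]
    (Mx : MDP Sx Ax) (My : MDP Sy Ay) (hx : Mx.Regular) (hy : My.Regular)
    (hopt : ∃ π : Policy Sy Ay, My.IsOptimal π) :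
    (∃ (φ : Sx → Sy) (ψ : Ax → Ay), (φ, ψ) ∈ reductions Mx My) ↔
      ∃ (f : Sx → Sy) (g : Ay → Ax) (π : Policy Sy Ay),
        Set.InjOn g My.optimalActions ∧ My.IsCovering π ∧
        Mx.IsOptimal (adaptedPolicy f g π) ∧
        ∃ σ : Sy × Ay × Sy → ℝ,
          HasLongRunLaw (translatedLaw Mx f g π) σ ∧ HasLongRunLaw (My.tripletLaw π) σ := by
  cases nonempty_fintype Sx
  cases nonempty_fintype Sy
  constructor
  · rintro ⟨φ, ψ, hr⟩
    obtain ⟨π, hπ⟩ := MDP.exists_isCovering hy.unichain hopt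
    obtain ⟨a₀, -⟩ := hx.dummyAction
    have hsec : ∀ b, ∃ a, b ∈ My.optimalActions → ψ a = b := fun b => by
      by_cases hb : b ∈ My.optimalActions
      · obtain ⟨y, hO⟩ := hb
        exact (hr.2.1 y b hO).2.imp fun a ha _ => ha
      · exact ⟨a₀, fun h => absurd h hb⟩
    choose g hg using hsec
    refine ⟨φ, g, π, fun b hb b' hb' h => ?_, hπ,
      isOptimal_adaptedPolicy_of_reduction hx.unichain hy.unichain hr hg hπ.1⟩
    rw [← hg b hb, ← hg b' hb', h]
  · rintro ⟨f, g, π, hg, hπ, hopt', σ, hσx, hσy⟩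
    exact exists_reduction_of_adaptedPolicy hx.unichain hy hg hπ hopt' hσx hσy
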